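/- Let $\mathcal{C}$ be an elementary topos, i.e. a finitely complete cartesian closed category with a subobject classifier $\Omega$. For an object $X$ let $PX=\Omega^X$ be its power object, $\in_X\rightarrowtail X\times PX$ the membership relation, $\wedge,\vee,\Rightarrow : PX\times PX\to PX$ and $\top,\bot:\mathbb{1}\to PX$ the morphisms induced, through the natural bijection $\mathrm{Sub}(\Gamma\times X)\simeq\mathrm{Hom}(\Gamma,PX)$, by the operations of the Heyting algebras $\mathrm{Sub}(\Gamma\times X)$, and $\preceq_X\rightarrowtail PX\times PX$ the equalizer of $\wedge$ and the first projection. A structuring element is a morphism $b:X\to PX$; let $R_b\rightarrowtail X\times X$ be the subobject whose transposed characteristic morphism is $b$, and let $\breve b:X\to PX$ be the transpose of the characteristic morphism of the image of $R_b$ under the exchange of the two factors. The erosion $\varepsilon[b]:PX\to PX$ is the transpose of the characteristic morphism of the pullback of the converse $\succeq_X$ of $\preceq_X$ along $\mathrm{Id}\times b:PX\times X\to PX\times PX$; in the internal language, $\varepsilon[b](Y)=\{x:X\mid b(x)\preceq_X Y\}$. The dilation $\delta[b]:PX\to PX$ is the transpose of the characteristic morphism of the image in $PX\times X$, under the projection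 to the last and first factors, of the pullback of $R_{\breve b}\times{\in_X}$ along $\mathrm{Id}\times\Delta_X\times\mathrm{Id}:X\times X\times PX\to X\times X\times X\times PX$; in the internal language, $\delta[b](Y)=\{x:X\mid \exists y.\ y\in_X\breve b(x)\wedge y\in_X Y\}$. For every object $X$ of $\mathcal{C}$ and every structuring element $b:X\to PX$, the following closed formula of the internal language of $\mathcal{C}$ (with $Y,Z$ variables of type $PX$) is valid, i.e. its interpretation is the top element of $\mathrm{Sub}(\mathbb{1})$: $$\forall Y.\ \forall Z.\ \ \delta[b](Y)\preceq_X Z\ \Leftrightarrow\ Y\preceq_X\varepsilon[b](Z).$$ Moreover $(PX,\wedge,\vee,\Rightarrow,\varepsilon[b],\delta[b],\bot,\top)$ is an internal HGC-algebra, i.e. an internal Heyting algebra equipped with an internal order-preserving Galois connection: the diagrams expressing the laws of Heyting algebras commute for $(PX,\wedge,\vee,\Rightarrow,\bot,\top)$; $\delta[b]$ and $\varepsilon[b]$ are internally monotone, i.e. the formulas $\forall Y.\forall Z.\ Y\preceq_X Z\Rightarrow\delta[b](Y)\preceq_X\delta[b](Z)$ and $\forall Y.\forall Z.\ Y\preceq_X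 Z\Rightarrow\varepsilon[b](Y)\preceq_X\varepsilon[b](Z)$ are valid; and $\delta[b]$ is internally left adjoint to $\varepsilon[b]$ by the formula above. -/

import Mathlib

open CategoryTheory Limits MonoidalCategory CartesianMonoidalCategory

universe v u

set_option linter.unusedSectionVars false

noncomputable section

namespace ToposMorphology

/-! ## Subobjects in an elementary topos

An elementary topos is a finitely complete cartesian closed category with a subobject classifier.
`Ω` is `HasSubobjectClassifier.Ω C`, exponentials are those of `MonoidalClosed C`, and products are
those of the cartesian monoidal structure. -/

section Topos

variable {C : Type u} [Category.{v} C] [CartesianMonoidalCategory C] [HasFiniteLimits C]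
  [HasSubobjectClassifier C]

/-- Morphisms `A ⟶ Ω` correspond to subobjects of `A`: a morphism `φ` is sent to the pullback of
`true` along `φ`, a subobject `S` to its characteristic morphism. -/
def classify {A : C} : (A ⟶ HasSubobjectClassifier.Ω C) ≃ Subobject A :=
  (Subobject.Classifier.representableBy
    (HasSubobjectClassifier.exists_classifier (C := C)).some).homEquiv

/-- The characteristic morphism of a subobject. -/
abbrev chi {A : C} (S : Subobject A) : A ⟶ HasSubobjectClassifier.Ω C := classify.symm S

theorem classify_comp {A B : C} (f : A ⟶ B) (φ : B ⟶ HasSubobjectClassifier.Ω C) :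
    classify (f ≫ φ) = (Subobject.pullback f).obj (classify φ) :=
  (Subobject.Classifier.representableBy
    (HasSubobjectClassifier.exists_classifier (C := C)).some).homEquiv_comp f φ

theorem comp_chi {A B : C} (f : A ⟶ B) (S : Subobject B) :
    f ≫ chi S = chi ((Subobject.pullback f).obj S) := by
  apply classify.injective
  simp [classify_comp]

theorem subobject_le_iff {A : C} (S T : Subobject A) :
    S ≤ T ↔ ∀ ⦃Γ : C⦄ (f : Γ ⟶ A), S.Factors f → T.Factors f :=
  ⟨fun h _ f hf => Subobject.factors_of_le f h hf,
    fun h => Subobject.le_of_factors (h _ (Subobject.factors_self S))⟩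

theorem subobject_eq_iff {A : C} (S T : Subobject A) :
    S = T ↔ ∀ ⦃Γ : C⦄ (f : Γ ⟶ A), S.Factors f ↔ T.Factors f :=
  ⟨fun h _ _ => h ▸ Iff.rfl, fun h => le_antisymm
    ((subobject_le_iff _ _).2 fun _ f => (h f).1) ((subobject_le_iff _ _).2 fun _ f => (h f).2)⟩

/-- Implication of subobjects: `S ⇒ T` is the equalizer of the characteristic morphisms of
`S ⊓ T` and `S`. -/
def impSub {A : C} (S T : Subobject A) : Subobject A :=
  equalizerSubobject (chi (S ⊓ T)) (chi S)

theorem impSub_factors_iff {A Γ : C} (S T : Subobject A) (f : Γ ⟶ A) :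
    (impSub S T).Factors f ↔
      ∀ ⦃Δ : C⦄ (g : Δ ⟶ Γ), S.Factors (g ≫ f) → T.Factors (g ≫ f) := by
  rw [impSub, equalizerSubobject_factors_iff, comp_chi, comp_chi, classify.symm.injective.eq_iff,
    subobject_eq_iff]
  simp only [Limits.pullback_factors_iff, Subobject.inf_factors]
  exact forall_congr' fun Δ => forall_congr' fun g => by tauto

variable [MonoidalClosed C]

/-- Universal quantification of a subobject along the projection `X ⊗ Γ ⟶ Γ`. -/
def forallSnd {X Γ : C} (S : Subobject (X ⊗ Γ)) : Subobject Γ :=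
  equalizerSubobject (MonoidalClosed.curry (chi S)) (MonoidalClosed.curry (chi ⊤))

theorem forallSnd_factors_iff {X Γ Δ : C} (S : Subobject (X ⊗ Γ)) (f : Δ ⟶ Γ) :
    (forallSnd S).Factors f ↔
      ∀ ⦃E : C⦄ (g : E ⟶ Δ) (x : E ⟶ X), S.Factors (lift x (g ≫ f)) := by
  rw [forallSnd, equalizerSubobject_factors_iff, ← MonoidalClosed.curry_natural_left,
    ← MonoidalClosed.curry_natural_left, MonoidalClosed.curry_injective.eq_iff, comp_chi, comp_chi,
    classify.symm.injective.eq_iff, subobject_eq_iff]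
  simp only [Limits.pullback_factors_iff, Subobject.top_factors, iff_true]
  constructor
  · intro h E g x
    have := h (lift x g)
    simpa using this
  · intro h E k
    have := h (k ≫ snd _ _) (k ≫ fst _ _)
    have e : k ≫ X ◁ f = lift (k ≫ fst X Δ) ((k ≫ snd X Δ) ≫ f) := by
      ext <;> simp
    rwa [e]

/-- `forallSnd` is right adjoint to pullback along the projection `X ⊗ Γ ⟶ Γ`. -/
theorem le_forallSnd_iff {X Γ : C} (T : Subobject Γ) (S : Subobject (X ⊗ Γ)) :
    T ≤ forallSnd S ↔ (Subobject.pullback (snd X Γ)).obj T ≤ S := by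
  simp only [subobject_le_iff, forallSnd_factors_iff, Limits.pullback_factors_iff]
  constructor
  · intro h E k hk
    have := h _ hk (𝟙 _) (k ≫ fst _ _)
    have e : k = lift (k ≫ fst X Γ) (𝟙 _ ≫ k ≫ snd X Γ) := by ext <;> simp
    rwa [e]
  · intro h Δ f hf E g x
    apply h
    simpa using Subobject.factors_of_factors_right g hf

/-- The join of two subobjects, `{a | ∀ w : Ω, (a ∈ S ⇒ w) ∧ (a ∈ T ⇒ w) ⇒ w}`. -/
def supSub {A : C} (S T : Subobject A) : Subobject A :=
  let w : Subobject (HasSubobjectClassifier.Ω C ⊗ A) := classify (fst _ _)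
  let p := Subobject.pullback (snd (HasSubobjectClassifier.Ω C) A)
  forallSnd (impSub (impSub (p.obj S) w ⊓ impSub (p.obj T) w) w)

/-- The smallest subobject, `{a | ∀ w : Ω, w}`. -/
def botSub (A : C) : Subobject A :=
  forallSnd (classify (fst (HasSubobjectClassifier.Ω C) A))

theorem classify_factors_iff {A Γ : C} (φ : A ⟶ HasSubobjectClassifier.Ω C) (f : Γ ⟶ A) :
    (classify φ).Factors f ↔ (classify (f ≫ φ)) = ⊤ := by
  rw [classify_comp, subobject_eq_iff]
  simp only [Limits.pullback_factors_iff, Subobject.top_factors, iff_true]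
  exact ⟨fun h Δ g => Subobject.factors_of_factors_right g h, fun h => by simpa using h (𝟙 _)⟩

theorem classify_fst_factors_iff {A B Γ : C} (f : Γ ⟶ HasSubobjectClassifier.Ω C ⊗ B)
    (U : Subobject A) (g : Γ ⟶ A) (h : f ≫ fst _ _ = g ≫ chi U) :
    (classify (fst (HasSubobjectClassifier.Ω C) B)).Factors f ↔ U.Factors g := by
  rw [classify_factors_iff, h, ← classify_factors_iff, Equiv.apply_symm_apply]

theorem le_supSub_left {A : C} (S T : Subobject A) : S ≤ supSub S T := by
  simp only [subobject_le_iff, supSub, forallSnd_factors_iff, impSub_factors_iff,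
    Subobject.inf_factors, Limits.pullback_factors_iff]
  intro Γ f hf E g w Δ h hh
  have := hh.1 (𝟙 _)
  simp only [Category.id_comp, Category.assoc, lift_snd] at this
  exact this (Subobject.factors_of_factors_right _ (Subobject.factors_of_factors_right _ hf))

theorem le_supSub_right {A : C} (S T : Subobject A) : T ≤ supSub S T := by
  simp only [subobject_le_iff, supSub, forallSnd_factors_iff, impSub_factors_iff,
    Subobject.inf_factors, Limits.pullback_factors_iff]
  intro Γ f hf E g w Δ h hh
  have := hh.2 (𝟙 _)
  simp only [Category.id_comp, Category.assoc, lift_snd] at this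
  exact this (Subobject.factors_of_factors_right _ (Subobject.factors_of_factors_right _ hf))

theorem supSub_le {A : C} {S T U : Subobject A} (hS : S ≤ U) (hT : T ≤ U) : supSub S T ≤ U := by
  simp only [subobject_le_iff, supSub, forallSnd_factors_iff, impSub_factors_iff,
    Subobject.inf_factors, Limits.pullback_factors_iff] at *
  intro Γ f hf
  have := hf (𝟙 _) (f ≫ chi U) (𝟙 _)
  rw [classify_fst_factors_iff _ U f (by simp)] at this
  refine this ⟨?_, ?_⟩
  · intro Δ g hg
    rw [classify_fst_factors_iff _ U (g ≫ f) (by simp)]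
    exact hS _ (by simpa using hg)
  · intro Δ g hg
    rw [classify_fst_factors_iff _ U (g ≫ f) (by simp)]
    exact hT _ (by simpa using hg)

theorem botSub_le {A : C} (U : Subobject A) : botSub A ≤ U := by
  simp only [subobject_le_iff, botSub, forallSnd_factors_iff]
  intro Γ f hf
  exact (classify_fst_factors_iff _ U f (by simp)).1 (hf (𝟙 _) (f ≫ chi U))

/-- The Heyting algebra structure on the poset of subobjects of an object of a topos. -/
instance subobjectHeyting (A : C) : HeytingAlgebra (Subobject A) where
  __ := (inferInstance : SemilatticeInf (Subobject A))
  __ := (inferInstance : OrderTop (Subobject A))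
  sup := supSub
  le_sup_left := le_supSub_left
  le_sup_right := le_supSub_right
  sup_le _ _ _ := supSub_le
  bot := botSub A
  bot_le := botSub_le
  himp := impSub
  le_himp_iff a b c := by
    simp only [subobject_le_iff, impSub_factors_iff, Subobject.inf_factors]
    constructor
    · intro h Γ f hf
      simpa using h f hf.1 (𝟙 _) (by simpa using hf.2)
    · intro h Γ f hf Δ g hg
      exact h _ ⟨Subobject.factors_of_factors_right _ hf, hg⟩
  compl S := impSub S (botSub A)
  himp_bot _ := rfl

/-! ## Power objects -/

/-- The power object `P X = Ω ^ X`. -/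
abbrev PowObj (X : C) : C := (ihom X).obj (HasSubobjectClassifier.Ω C)

/-- The transpose bijection `Hom(Γ × X, Ω) ≃ Hom(Γ, P X)`. -/
def transpose {Γ X : C} : (Γ ⊗ X ⟶ HasSubobjectClassifier.Ω C) ≃ (Γ ⟶ PowObj X) where
  toFun φ := MonoidalClosed.curry (lift (snd X Γ) (fst X Γ) ≫ φ)
  invFun f := lift (snd Γ X) (fst Γ X) ≫ MonoidalClosed.uncurry f
  left_inv φ := by
    dsimp only
    rw [MonoidalClosed.uncurry_curry, ← Category.assoc]
    simp
  right_inv f := by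
    dsimp only
    rw [← Category.assoc]
    simp

/-- The subobject `R` of `Γ × X` whose transposed characteristic morphism is `f : Γ ⟶ P X`. -/
def rel {Γ X : C} (f : Γ ⟶ PowObj X) : Subobject (Γ ⊗ X) := classify (transpose.symm f)

/-- The transpose of the characteristic morphism of a subobject of `Γ × X`. -/
def name {Γ X : C} (R : Subobject (Γ ⊗ X)) : Γ ⟶ PowObj X := transpose (chi R)

/-- The membership relation `∈_X`, a subobject of `X × P X`. -/
def mem (X : C) : Subobject (X ⊗ PowObj X) :=
  (Subobject.pullback (lift (snd X (PowObj X)) (fst X (PowObj X)))).obj (rel (𝟙 (PowObj X)))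

theorem rel_comp {Γ Δ X : C} (g : Δ ⟶ Γ) (f : Γ ⟶ PowObj X) :
    rel (g ≫ f) = (Subobject.pullback (g ▷ X)).obj (rel f) := by
  rw [rel, rel, ← classify_comp]
  congr 1
  simp only [transpose, Equiv.coe_fn_symm_mk, MonoidalClosed.uncurry_natural_left]
  rw [← Category.assoc, ← Category.assoc]
  congr 1
  ext <;> simp

theorem rel_name {Γ X : C} (R : Subobject (Γ ⊗ X)) : rel (name R) = R := by
  simp [rel, name]

theorem mem_factors_iff {Γ X : C} (x : Γ ⟶ X) (p : Γ ⟶ PowObj X) :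
    (mem X).Factors (lift x p) ↔ (rel p).Factors (lift (𝟙 Γ) x) := by
  have e : rel p = (Subobject.pullback (p ▷ X)).obj (rel (𝟙 _)) := by
    rw [← rel_comp, Category.comp_id]
  rw [e, mem, Limits.pullback_factors_iff, Limits.pullback_factors_iff]
  simp

/-! ## Images -/

/-- The image of `f`, `{b | ∀ U : P B, (∀ a, f a ∈ U) ⇒ b ∈ U}`. -/
def imageSub {A B : C} (f : A ⟶ B) : Subobject B :=
  forallSnd (X := PowObj B) (impSub
    ((Subobject.pullback (fst (PowObj B) B)).obj
      (forallSnd ((Subobject.pullback (f ▷ PowObj B)).obj (mem B))))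
    ((Subobject.pullback (lift (snd (PowObj B) B) (fst (PowObj B) B))).obj (mem B)))

theorem imageSub_factors {A B : C} (f : A ⟶ B) : (imageSub f).Factors f := by
  simp only [imageSub, forallSnd_factors_iff, impSub_factors_iff, Limits.pullback_factors_iff]
  intro Γ a U Δ g h
  have := h (𝟙 _) (g ≫ a)
  simpa using this

theorem imageSub_le {A B : C} (f : A ⟶ B) (T : Subobject B) (h : T.Factors f) :
    imageSub f ≤ T := by
  simp only [subobject_le_iff, imageSub, forallSnd_factors_iff, impSub_factors_iff,
    Limits.pullback_factors_iff]
  intro Γ b hb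
  have key : ∀ {Δ : C} (y : Δ ⟶ B) (k : Δ ⟶ 𝟙_ C),
      (mem B).Factors (lift y (k ≫ name ((Subobject.pullback (snd (𝟙_ C) B)).obj T))) ↔
        T.Factors y := by
    intro Δ y k
    rw [mem_factors_iff, rel_comp, rel_name, Limits.pullback_factors_iff,
      Limits.pullback_factors_iff]
    simp
  have := hb (𝟙 _) (toUnit _ ≫ name ((Subobject.pullback (snd (𝟙_ C) B)).obj T)) (𝟙 _)
  simp only [Category.id_comp, comp_lift, lift_fst, lift_snd, lift_whiskerRight,
    key] at this
  refine this ?_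
  intro E g a
  rw [← Category.assoc, key]
  exact Subobject.factors_of_factors_right _ h

/-- A topos has images: `imageSub f` is the smallest subobject through which `f` factors. -/
instance hasImages : HasImages C where
  has_image {A B} f := HasImage.mk
    { F :=
        { I := (imageSub f : C)
          m := (imageSub f).arrow
          e := (imageSub f).factorThru f (imageSub_factors f) }
      isImage :=
        { lift := fun F =>
            have := F.m_mono
            Subobject.ofLEMk (imageSub f) F.m (imageSub_le f _
              ((Subobject.mk_factors_iff _ _).2 ⟨F.e, F.fac⟩))
          lift_fac := fun F => by simp } }

/-! ## The internal Heyting algebra `P X` and its order -/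

/-- The operations of an internal Heyting algebra on `L`. -/
structure HeytingOps (L : C) where
  meet : L ⊗ L ⟶ L
  join : L ⊗ L ⟶ L
  imp : L ⊗ L ⟶ L
  top : 𝟙_ C ⟶ L
  bot : 𝟙_ C ⟶ L

/-- The commutative diagrams defining an internal Heyting algebra, each written as an equation
between morphisms into `L` for all generalized elements of `L`. -/
structure IsInternalHeyting {L : C} (H : HeytingOps L) : Prop where
  meet_comm : ∀ ⦃Γ : C⦄ (x y : Γ ⟶ L), lift x y ≫ H.meet = lift y x ≫ H.meet
  join_comm : ∀ ⦃Γ : C⦄ (x y : Γ ⟶ L), lift x y ≫ H.join = lift y x ≫ H.join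
  meet_assoc : ∀ ⦃Γ : C⦄ (x y z : Γ ⟶ L),
    lift (lift x y ≫ H.meet) z ≫ H.meet = lift x (lift y z ≫ H.meet) ≫ H.meet
  join_assoc : ∀ ⦃Γ : C⦄ (x y z : Γ ⟶ L),
    lift (lift x y ≫ H.join) z ≫ H.join = lift x (lift y z ≫ H.join) ≫ H.join
  meet_idem : ∀ ⦃Γ : C⦄ (x : Γ ⟶ L), lift x x ≫ H.meet = x
  join_idem : ∀ ⦃Γ : C⦄ (x : Γ ⟶ L), lift x x ≫ H.join = x
  meet_join : ∀ ⦃Γ : C⦄ (x y : Γ ⟶ L), lift x (lift x y ≫ H.join) ≫ H.meet = x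
  join_meet : ∀ ⦃Γ : C⦄ (x y : Γ ⟶ L), lift x (lift x y ≫ H.meet) ≫ H.join = x
  meet_top : ∀ ⦃Γ : C⦄ (x : Γ ⟶ L), lift x (toUnit Γ ≫ H.top) ≫ H.meet = x
  join_bot : ∀ ⦃Γ : C⦄ (x : Γ ⟶ L), lift x (toUnit Γ ≫ H.bot) ≫ H.join = x
  imp_self : ∀ ⦃Γ : C⦄ (x : Γ ⟶ L), lift x x ≫ H.imp = toUnit Γ ≫ H.top
  meet_imp : ∀ ⦃Γ : C⦄ (x y : Γ ⟶ L),
    lift x (lift x y ≫ H.imp) ≫ H.meet = lift x y ≫ H.meet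
  meet_imp_right : ∀ ⦃Γ : C⦄ (x y : Γ ⟶ L), lift y (lift x y ≫ H.imp) ≫ H.meet = y
  imp_meet : ∀ ⦃Γ : C⦄ (x y z : Γ ⟶ L),
    lift x (lift y z ≫ H.meet) ≫ H.imp =
      lift (lift x y ≫ H.imp) (lift x z ≫ H.imp) ≫ H.meet

/-- The operations on `P X`, obtained from those of the Heyting algebras `Sub(Γ × X)` through the
bijection `Sub(Γ × X) ≃ Hom(Γ, P X)`. -/
def powOps (X : C) : HeytingOps (PowObj X) where
  meet := name (rel (fst (PowObj X) (PowObj X)) ⊓ rel (snd (PowObj X) (PowObj X)))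
  join := name (rel (fst (PowObj X) (PowObj X)) ⊔ rel (snd (PowObj X) (PowObj X)))
  imp := name (rel (fst (PowObj X) (PowObj X)) ⇨ rel (snd (PowObj X) (PowObj X)))
  top := name ⊤
  bot := name ⊥

/-- The internal order of `L`: the equalizer of the meet and the first projection. -/
def leSub {L : C} (H : HeytingOps L) : Subobject (L ⊗ L) :=
  equalizerSubobject H.meet (fst L L)

/-- The internal order `⪯_X`, a subobject of `P X × P X`. -/
def powLe (X : C) : Subobject (PowObj X ⊗ PowObj X) := leSub (powOps X)

/-- The converse relation `⪰_X`. -/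
def powGe (X : C) : Subobject (PowObj X ⊗ PowObj X) :=
  (Subobject.pullback (lift (snd (PowObj X) (PowObj X)) (fst (PowObj X) (PowObj X)))).obj (powLe X)

/-! ## Erosion and dilation by a structuring element `b : X ⟶ P X` -/

/-- The transposed structuring element: the transpose of the morphism classifying the image of
`R_b ⟶ X × X ⟶ (X × X) × (X × X) ⟶ X × X`, the diagonal followed by `p₂ × p₁`. -/
def breve {X : C} (b : X ⟶ PowObj X) : X ⟶ PowObj X :=
  name (imageSubobject
    ((rel b).arrow ≫ lift (𝟙 (X ⊗ X)) (𝟙 (X ⊗ X)) ≫ (snd X X ⊗ₘ fst X X)))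

/-- The erosion by `b`: it names the pullback of `⪰_X` along `Id × b`. -/
def erosion {X : C} (b : X ⟶ PowObj X) : PowObj X ⟶ PowObj X :=
  name ((Subobject.pullback (PowObj X ◁ b)).obj (powGe X))

instance mono_prod {A B : C} (S : Subobject A) (T : Subobject B) : Mono (S.arrow ⊗ₘ T.arrow) where
  right_cancellation f g h := by
    have h1 := congrArg (fun k => k ≫ fst _ _) h
    have h2 := congrArg (fun k => k ≫ snd _ _) h
    simp only [Category.assoc, tensorHom_fst, tensorHom_snd] at h1 h2
    simp only [← Category.assoc, cancel_mono] at h1 h2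
    exact CartesianMonoidalCategory.hom_ext _ _ h1 h2

/-- The product `S × T` of two subobjects, a subobject of `A × B`. -/
def prodSub {A B : C} (S : Subobject A) (T : Subobject B) : Subobject (A ⊗ B) :=
  Subobject.mk (S.arrow ⊗ₘ T.arrow)

/-- The subobject `R` of `X × (X × P X)` in the definition of the dilation: the pullback of
`R_b̆ × ∈_X` along the morphism `(x, y, Y) ↦ ((x, y), (y, Y))`. -/
def dilationRel {X : C} (b : X ⟶ PowObj X) : Subobject (X ⊗ (X ⊗ PowObj X)) :=
  (Subobject.pullback (lift (X ◁ fst X (PowObj X)) (snd X (X ⊗ PowObj X)))).obj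
    (prodSub (rel (breve b)) (mem X))

/-- The dilation by `b`: it names the image of `R` under the projection
`X × (X × P X) ⟶ P X × X` to the last and the first argument. -/
def dilation {X : C} (b : X ⟶ PowObj X) : PowObj X ⟶ PowObj X :=
  name (imageSubobject ((dilationRel b).arrow ≫
    lift (snd X (X ⊗ PowObj X) ≫ snd X (PowObj X)) (fst X (X ⊗ PowObj X))))

/-! ## The internal language -/

section Language

/-- Typed variables (de Bruijn indices) in a context, a list of objects. -/
inductive Var : List C → C → Type u
  | zero {Γ : List C} {X : C} : Var (X :: Γ) X
  | succ {Γ : List C} {X Y : C} : Var Γ X → Var (Y :: Γ) X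

/-- Terms of the internal language, in a context and of a type. Formulas are the terms of
type `Ω`. -/
inductive Term : List C → C → Type (max u v)
  | var {Γ : List C} {X : C} : Var Γ X → Term Γ X
  | app {Γ : List C} {X Y : C} : (X ⟶ Y) → Term Γ X → Term Γ Y
  | star {Γ : List C} : Term Γ (𝟙_ C)
  | pair {Γ : List C} {X Y : C} : Term Γ X → Term Γ Y → Term Γ (X ⊗ Y)
  | proj₁ {Γ : List C} {X Y : C} : Term Γ (X ⊗ Y) → Term Γ X
  | proj₂ {Γ : List C} {X Y : C} : Term Γ (X ⊗ Y) → Term Γ Y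
  | compr {Γ : List C} (X : C) : Term (X :: Γ) (HasSubobjectClassifier.Ω C) → Term Γ (PowObj X)
  | tru {Γ : List C} : Term Γ (HasSubobjectClassifier.Ω C)
  | eq {Γ : List C} {X : C} : Term Γ X → Term Γ X → Term Γ (HasSubobjectClassifier.Ω C)
  | mem {Γ : List C} {X : C} : Term Γ X → Term Γ (PowObj X) → Term Γ (HasSubobjectClassifier.Ω C)
  | le {Γ : List C} {X : C} :
      Term Γ (PowObj X) → Term Γ (PowObj X) → Term Γ (HasSubobjectClassifier.Ω C)
  | and {Γ : List C} : Term Γ (HasSubobjectClassifier.Ω C) →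
      Term Γ (HasSubobjectClassifier.Ω C) → Term Γ (HasSubobjectClassifier.Ω C)
  | or {Γ : List C} : Term Γ (HasSubobjectClassifier.Ω C) →
      Term Γ (HasSubobjectClassifier.Ω C) → Term Γ (HasSubobjectClassifier.Ω C)
  | imp {Γ : List C} : Term Γ (HasSubobjectClassifier.Ω C) →
      Term Γ (HasSubobjectClassifier.Ω C) → Term Γ (HasSubobjectClassifier.Ω C)
  | neg {Γ : List C} : Term Γ (HasSubobjectClassifier.Ω C) → Term Γ (HasSubobjectClassifier.Ω C)
  | all {Γ : List C} (X : C) :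
      Term (X :: Γ) (HasSubobjectClassifier.Ω C) → Term Γ (HasSubobjectClassifier.Ω C)
  | ex {Γ : List C} (X : C) :
      Term (X :: Γ) (HasSubobjectClassifier.Ω C) → Term Γ (HasSubobjectClassifier.Ω C)

/-- Formulas are terms of type `Ω`. -/
abbrev Formula (Γ : List C) : Type (max u v) := Term Γ (HasSubobjectClassifier.Ω C)

/-- Logical equivalence, as two implications. -/
def Term.iff {Γ : List C} (φ ψ : Formula Γ) : Formula Γ := (φ.imp ψ).and (ψ.imp φ)

end Language

/-- The product of the types of a context. -/
def ctxObj : List C → C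
  | [] => 𝟙_ C
  | X :: Γ => X ⊗ ctxObj Γ

/-- A variable denotes a projection. -/
def Var.sem : {Γ : List C} → {X : C} → Var Γ X → (ctxObj Γ ⟶ X)
  | X :: Γ, _, .zero => fst X (ctxObj Γ)
  | Y :: Γ, _, .succ i => snd Y (ctxObj Γ) ≫ i.sem

/-- The interpretation of a term as a morphism out of the product of the context. A formula denotes
a subobject of that product, here represented by its characteristic morphism. -/
def Term.sem : {Γ : List C} → {X : C} → Term Γ X → (ctxObj Γ ⟶ X)
  | _, _, .var i => i.sem
  | _, _, .app f t => t.sem ≫ f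
  | _, _, .star => toUnit _
  | _, _, .pair s t => lift s.sem t.sem
  | _, _, .proj₁ t => t.sem ≫ fst _ _
  | _, _, .proj₂ t => t.sem ≫ snd _ _
  | Γ, _, .compr X φ =>
      name ((Subobject.pullback (lift (snd (ctxObj Γ) X) (fst (ctxObj Γ) X))).obj (classify φ.sem))
  | _, _, .tru => chi ⊤
  | _, _, .eq s t => chi (equalizerSubobject s.sem t.sem)
  | _, _, .mem (X := X) s t =>
      chi ((Subobject.pullback (lift s.sem t.sem)).obj (ToposMorphology.mem X))
  | _, _, .le (X := X) s t => chi ((Subobject.pullback (lift s.sem t.sem)).obj (powLe X))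
  | _, _, .and φ ψ => chi (classify φ.sem ⊓ classify ψ.sem)
  | _, _, .or φ ψ => chi (classify φ.sem ⊔ classify ψ.sem)
  | _, _, .imp φ ψ => chi (classify φ.sem ⇨ classify ψ.sem)
  | _, _, .neg φ => chi (classify φ.sem)ᶜ
  | _, _, .all _ φ => chi (forallSnd (classify φ.sem))
  | Γ, _, .ex X φ => chi (imageSubobject ((classify φ.sem).arrow ≫ snd X (ctxObj Γ)))

/-- The subobject of the product of the context denoted by a formula. -/
def Term.sub {Γ : List C} (φ : Formula Γ) : Subobject (ctxObj Γ) := classify φ.sem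

/-- A formula is valid if it denotes the largest subobject of the product of its context. -/
def Term.Valid {Γ : List C} (φ : Formula Γ) : Prop := φ.sub = ⊤

/-! ## Internal HGC-algebras -/

/-- The formula `s ≤ t` for the order of an internal lattice: `s ∧ t = s`. -/
def HeytingOps.leFormula {L : C} (H : HeytingOps L) {Γ : List C} (s t : Term Γ L) : Formula Γ :=
  .eq (.app H.meet (.pair s t)) s

/-- An internal HGC-algebra: an internal Heyting algebra with an internal order-preserving Galois
connection whose lower adjoint is `d` and whose upper adjoint is `e`, that is, the closed formulas
`∀ y z, y ≤ z ⇒ d y ≤ d z`, `∀ y z, y ≤ z ⇒ e y ≤ e z` and `∀ y z, d y ≤ z ⇔ y ≤ e z` are valid. -/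
structure IsInternalHGC {L : C} (H : HeytingOps L) (d e : L ⟶ L) : Prop where
  heyting : IsInternalHeyting H
  lower_mono : (Term.all (Γ := []) L (.all L ((H.leFormula (.var (.succ .zero)) (.var .zero)).imp
    (H.leFormula (.app d (.var (.succ .zero))) (.app d (.var .zero)))))).Valid
  upper_mono : (Term.all (Γ := []) L (.all L ((H.leFormula (.var (.succ .zero)) (.var .zero)).imp
    (H.leFormula (.app e (.var (.succ .zero))) (.app e (.var .zero)))))).Valid
  galois : (Term.all (Γ := []) L (.all L
    ((H.leFormula (.app d (.var (.succ .zero))) (.var .zero)).iff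
      (H.leFormula (.var (.succ .zero)) (.app e (.var .zero)))))).Valid

end Topos

end ToposMorphology

end

open ToposMorphology

namespace ToposMorphology

section Topos

variable {C : Type u} [Category.{v} C] [CartesianMonoidalCategory C] [HasFiniteLimits C]
  [HasSubobjectClassifier C] [MonoidalClosed C]

/-! ### Generalized elements of power objects -/

/-! The whole statement is checked on generalized elements. A morphism `p : Γ ⟶ PowObj X` is the
same as the subobject `rel p` of `Γ ⊗ X`. The Heyting operations on subobjects are stable under
pullback, so the operations of `powOps X` become those of the Heyting algebra of subobjects
(`rel_meet`, `rel_join`, `rel_imp`), the Heyting laws hold because they hold there, and the internal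
order becomes inclusion (`meet_eq_left_iff`, `powLe_factors_iff`).

For the adjunction, both inequalities say the same thing: at every later stage, `y ∈ p` and `x ∈
b(y)` imply `x ∈ q`. For the erosion this is a direct unfolding (`rel_erosion_factors_iff`). For the
dilation an existential quantifier must be eliminated (`rel_dilation_le_iff`), which rests on the
impredicative description of images (`factors_of_imageSubobject_factors`). Monotonicity of both
operators follows formally from the adjunction.

Kripke–Joyal clauses for `∀`, `⇒` and `⇔` then turn validity of the closed formulas into these
statements about generalized elements. -/

theorem rel_injective {Γ X : C} :
    Function.Injective (rel : (Γ ⟶ PowObj X) → Subobject (Γ ⊗ X)) := fun _ _ h =>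
  transpose.symm.injective (classify.injective h)

theorem rel_comp_name {Γ Δ X : C} (g : Δ ⟶ Γ) (R : Subobject (Γ ⊗ X)) :
    rel (g ≫ name R) = (Subobject.pullback (g ▷ X)).obj R := by
  rw [rel_comp, rel_name]

theorem rel_comp_factors_iff {Γ Δ E X : C} (g : Δ ⟶ Γ) (f : Γ ⟶ PowObj X) (a : E ⟶ Δ)
    (x : E ⟶ X) : (rel (g ≫ f)).Factors (lift a x) ↔ (rel f).Factors (lift (a ≫ g) x) := by
  rw [rel_comp, Limits.pullback_factors_iff, lift_whiskerRight]

theorem mem_factors_iff_rel {Γ Δ X : C} (a : Δ ⟶ Γ) (x : Δ ⟶ X) (p : Γ ⟶ PowObj X) :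
    (mem X).Factors (lift x (a ≫ p)) ↔ (rel p).Factors (lift a x) := by
  rw [mem_factors_iff, rel_comp_factors_iff, Category.id_comp]

/-- The forcing condition for implication already quantifies over all later stages and sees `g` only
through `g ≫ f`. -/
theorem pullback_himp {A B : C} (f : A ⟶ B) (S T : Subobject B) :
    (Subobject.pullback f).obj (S ⇨ T) =
      (Subobject.pullback f).obj S ⇨ (Subobject.pullback f).obj T := by
  change (Subobject.pullback f).obj (impSub S T) = impSub _ _
  rw [subobject_eq_iff]
  intro Γ g
  simp only [Limits.pullback_factors_iff, impSub_factors_iff, Category.assoc]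

/-- Stability comes from the second-order encoding of the join: it is built from `∀` over `Ω` and
`⇒`, whose forcing conditions are compatible with base change. -/
theorem pullback_sup {A B : C} (f : A ⟶ B) (S T : Subobject B) :
    (Subobject.pullback f).obj (S ⊔ T) =
      (Subobject.pullback f).obj S ⊔ (Subobject.pullback f).obj T := by
  change (Subobject.pullback f).obj (supSub S T) = supSub _ _
  rw [subobject_eq_iff]
  intro Γ g
  simp only [Limits.pullback_factors_iff, supSub, forallSnd_factors_iff, impSub_factors_iff,
    Subobject.inf_factors, classify_factors_iff, Category.assoc, lift_snd, lift_fst]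

theorem pullback_bot {A B : C} (f : A ⟶ B) : (Subobject.pullback f).obj (⊥ : Subobject B) = ⊥ := by
  change (Subobject.pullback f).obj (botSub B) = botSub A
  rw [subobject_eq_iff]
  intro Γ g
  simp only [Limits.pullback_factors_iff, botSub, forallSnd_factors_iff, classify_factors_iff,
    lift_fst]

theorem pullback_inf {A B : C} (f : A ⟶ B) (S T : Subobject B) :
    (Subobject.pullback f).obj (S ⊓ T) =
      (Subobject.pullback f).obj S ⊓ (Subobject.pullback f).obj T :=
  Subobject.inf_pullback f S T

theorem rel_meet {Γ X : C} (p q : Γ ⟶ PowObj X) :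
    rel (lift p q ≫ (powOps X).meet) = rel p ⊓ rel q := by
  simp only [powOps, rel_comp_name, pullback_inf, ← rel_comp, lift_fst, lift_snd]

theorem rel_join {Γ X : C} (p q : Γ ⟶ PowObj X) :
    rel (lift p q ≫ (powOps X).join) = rel p ⊔ rel q := by
  simp only [powOps, rel_comp_name, pullback_sup, ← rel_comp, lift_fst, lift_snd]

theorem rel_imp {Γ X : C} (p q : Γ ⟶ PowObj X) :
    rel (lift p q ≫ (powOps X).imp) = rel p ⇨ rel q := by
  simp only [powOps, rel_comp_name, pullback_himp, ← rel_comp, lift_fst, lift_snd]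

theorem rel_top {Γ : C} (X : C) : rel (toUnit Γ ≫ (powOps X).top) = ⊤ := by
  simp only [powOps, rel_comp_name, Subobject.pullback_top]

theorem rel_bot {Γ : C} (X : C) : rel (toUnit Γ ≫ (powOps X).bot) = ⊥ := by
  simp only [powOps, rel_comp_name, pullback_bot]

theorem isInternalHeyting_powOps (X : C) : IsInternalHeyting (powOps X) := by
  constructor <;> intros <;> apply rel_injective <;>
    simp only [rel_meet, rel_join, rel_imp, rel_top, rel_bot]
  · exact inf_comm _ _
  · exact sup_comm _ _
  · exact inf_assoc _ _ _
  · exact sup_assoc _ _ _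
  · exact inf_idem _
  · exact sup_idem _
  · exact inf_sup_self
  · exact sup_inf_self
  · exact inf_top_eq _
  · exact sup_bot_eq _
  · exact himp_self
  · exact inf_himp _ _
  · exact inf_eq_left.2 le_himp
  · exact himp_inf_distrib _ _ _

/-- This is the bridge between the equational internal order and inclusion; it serves both `powLe`
and `HeytingOps.leFormula`. -/
theorem meet_eq_left_iff {Γ X : C} (p q : Γ ⟶ PowObj X) :
    lift p q ≫ (powOps X).meet = p ↔ rel p ≤ rel q := by
  rw [← rel_injective.eq_iff, rel_meet]
  exact inf_eq_left

theorem powLe_factors_iff {Γ X : C} (p q : Γ ⟶ PowObj X) :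
    (powLe X).Factors (lift p q) ↔ rel p ≤ rel q := by
  rw [powLe, leSub, equalizerSubobject_factors_iff, lift_fst, meet_eq_left_iff]

theorem rel_le_rel_iff {Γ X : C} (p q : Γ ⟶ PowObj X) :
    rel p ≤ rel q ↔ ∀ ⦃Δ : C⦄ (a : Δ ⟶ Γ) (x : Δ ⟶ X),
      (rel p).Factors (lift a x) → (rel q).Factors (lift a x) := by
  rw [subobject_le_iff]
  refine ⟨fun h Δ a x => h _, fun h Δ f => ?_⟩
  have e : f = lift (f ≫ fst _ _) (f ≫ snd _ _) := by ext <;> simp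
  rw [e]
  exact h _ _

/-! ### Images -/

theorem imageSubobject_factors {A B : C} (f : A ⟶ B) : (imageSubobject f).Factors f := by
  simpa using imageSubobject_factors_comp_self f (𝟙 A)

theorem imageSubobject_le_iff {A B : C} (f : A ⟶ B) (T : Subobject B) :
    imageSubobject f ≤ T ↔ T.Factors f :=
  ⟨fun h => Subobject.factors_of_le f h (imageSubobject_factors f),
    fun h => imageSubobject_le f (T.factorThru f h) (by simp)⟩

/-- Elimination of an existential quantifier: to prove a property of a generalized element of an
image, one may assume that it comes from the source, at the cost of changing the stage. -/
theorem factors_of_imageSubobject_factors {A B Γ : C} (f : A ⟶ B) (k : Γ ⟶ B)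
    (hk : (imageSubobject f).Factors k) (U : Subobject (Γ ⊗ B))
    (hU : ∀ ⦃Δ : C⦄ (g : Δ ⟶ Γ) (a : Δ ⟶ A), U.Factors (lift g (a ≫ f))) :
    U.Factors (lift (𝟙 Γ) k) := by
  -- By minimality the image lies in `imageSub f`, whose definition quantifies over all subsets of
  -- `B`.
  have h := Subobject.factors_of_le k
    ((imageSubobject_le_iff f (imageSub f)).2 (imageSub_factors f)) hk
  simp only [imageSub, forallSnd_factors_iff, impSub_factors_iff, Limits.pullback_factors_iff,
    comp_lift, lift_fst, lift_snd, lift_whiskerRight] at h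
  -- The quantified subset is taken to be the `Γ`-indexed family `U`, so the property may depend on
  -- parameters from `Γ`.
  have := h (𝟙 _) (name U) (𝟙 _)
  simp only [Category.id_comp, mem_factors_iff_rel, rel_name] at this
  have key := this fun E g a => hU g a
  rwa [mem_factors_iff, rel_name] at key

/-! ### Dilation and erosion of generalized elements -/

/-- Exchanging the factors is an involution, so here membership in the image needs no change of
stage: minimality against the pullback of `rel b` along the exchange gives one direction, an
explicit factorization the other. -/
theorem rel_breve_factors_iff {Γ X : C} (b : X ⟶ PowObj X) (x y : Γ ⟶ X) :
    (rel (breve b)).Factors (lift x y) ↔ (rel b).Factors (lift y x) := by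
  rw [breve, rel_name]
  constructor
  · intro h
    have h' := Subobject.factors_of_le (lift x y) ((imageSubobject_le_iff _
      ((Subobject.pullback (lift (snd X X) (fst X X))).obj (rel b))).2 ?_) h
    · simpa [Limits.pullback_factors_iff] using h'
    · rw [Limits.pullback_factors_iff]
      have e : ((rel b).arrow ≫ lift (𝟙 (X ⊗ X)) (𝟙 (X ⊗ X)) ≫ (snd X X ⊗ₘ fst X X)) ≫
          lift (snd X X) (fst X X) = (rel b).arrow := by
        ext <;> simp
      rw [e]
      exact Subobject.factors_self _
  · intro h
    have e : lift x y = (rel b).factorThru _ h ≫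
        ((rel b).arrow ≫ lift (𝟙 (X ⊗ X)) (𝟙 (X ⊗ X)) ≫ (snd X X ⊗ₘ fst X X)) := by
      rw [Subobject.factorThru_arrow_assoc]
      ext <;> simp
    rw [e]
    exact Subobject.factors_of_factors_right _ (imageSubobject_factors _)

theorem prodSub_factors_iff {A B Γ : C} (S : Subobject A) (T : Subobject B) (a : Γ ⟶ A)
    (c : Γ ⟶ B) : (prodSub S T).Factors (lift a c) ↔ S.Factors a ∧ T.Factors c := by
  rw [prodSub, Subobject.mk_factors_iff]
  constructor
  · intro h
    obtain ⟨g, hg⟩ : ∃ g : Γ ⟶ (S : C) ⊗ (T : C), g ≫ (S.arrow ⊗ₘ T.arrow) = lift a c := h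
    have h1 : (g ≫ fst _ _) ≫ S.arrow = a := by
      rw [Category.assoc, ← tensorHom_fst S.arrow T.arrow, ← Category.assoc, hg, lift_fst]
    have h2 : (g ≫ snd _ _) ≫ T.arrow = c := by
      rw [Category.assoc, ← tensorHom_snd S.arrow T.arrow, ← Category.assoc, hg, lift_snd]
    rw [← h1, ← h2]
    exact ⟨Subobject.factors_comp_arrow _, Subobject.factors_comp_arrow _⟩
  · rintro ⟨ha, hc⟩
    exact ⟨lift (S.factorThru a ha) (T.factorThru c hc), by simp⟩

theorem dilationRel_factors_iff {Γ X : C} (b : X ⟶ PowObj X) (x y : Γ ⟶ X) (p : Γ ⟶ PowObj X) :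
    (dilationRel b).Factors (lift x (lift y p)) ↔
      (rel b).Factors (lift y x) ∧ (mem X).Factors (lift y p) := by
  rw [dilationRel, Limits.pullback_factors_iff, ← rel_breve_factors_iff, ← prodSub_factors_iff]
  simp

/-- `δ[b](p) ⪯ q` if and only if `x ∈ q` whenever `x ∈ b(y)` for some `y ∈ p`. -/
theorem rel_dilation_le_iff {Γ X : C} (b : X ⟶ PowObj X) (p q : Γ ⟶ PowObj X) :
    rel (p ≫ dilation b) ≤ rel q ↔ ∀ ⦃Δ : C⦄ (a : Δ ⟶ Γ) (x y : Δ ⟶ X),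
      (rel p).Factors (lift a y) → (rel b).Factors (lift y x) → (rel q).Factors (lift a x) := by
  simp only [rel_le_rel_iff, rel_comp_factors_iff]
  rw [dilation, rel_name]
  constructor
  · intro h Δ a x y hy hx
    refine h a x ?_
    have hd : (dilationRel b).Factors (lift x (lift y (a ≫ p))) :=
      (dilationRel_factors_iff b x y _).2 ⟨hx, (mem_factors_iff_rel a y p).2 hy⟩
    have e : lift (a ≫ p) x = (dilationRel b).factorThru _ hd ≫ (dilationRel b).arrow ≫
        lift (snd X (X ⊗ PowObj X) ≫ snd X (PowObj X)) (fst X (X ⊗ PowObj X)) := by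
      rw [Subobject.factorThru_arrow_assoc]
      ext <;> simp
    rw [e]
    exact Subobject.factors_of_factors_right _ (imageSubobject_factors _)
  · intro h E c x hx
    -- The property of `(Y, x')` over `e : E` is `Y = p(c e) ⇒ x' ∈ q(c e)`. The antecedent
    -- remembers that the pair under study has first component `c ≫ p`, which a general element of
    -- the image does not have.
    have key := factors_of_imageSubobject_factors _ _ hx
      (impSub
        (equalizerSubobject (snd E (PowObj X ⊗ X) ≫ fst (PowObj X) X)
          (fst E (PowObj X ⊗ X) ≫ c ≫ p))
        ((Subobject.pullback (lift (fst E (PowObj X ⊗ X) ≫ c)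
          (snd E (PowObj X ⊗ X) ≫ snd (PowObj X) X))).obj (rel q))) ?_
    · rw [impSub_factors_iff] at key
      simpa [Limits.pullback_factors_iff] using key (𝟙 _)
        ((equalizerSubobject_factors_iff _ _ _).2 (by simp))
    · intro Δ g r
      rw [impSub_factors_iff]
      intro D j
      -- An element of the source of the image is a triple `(x', y', Y')` in `dilationRel b`; its
      -- `y'` is the existential witness.
      obtain ⟨x', y', Y', e, hd⟩ : ∃ (x' y' : D ⟶ X) (Y' : D ⟶ PowObj X),
          (j ≫ r) ≫ (dilationRel b).arrow = lift x' (lift y' Y') ∧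
            (dilationRel b).Factors (lift x' (lift y' Y')) := by
        let s := (j ≫ r) ≫ (dilationRel b).arrow
        have e : s = lift (s ≫ fst _ _) (lift (s ≫ snd _ _ ≫ fst _ _) (s ≫ snd _ _ ≫ snd _ _)) := by
          ext <;> simp
        exact ⟨_, _, _, e, e ▸ Subobject.factors_comp_arrow _⟩
      have e' : j ≫ lift g (r ≫ (dilationRel b).arrow ≫
          lift (snd X (X ⊗ PowObj X) ≫ snd X (PowObj X)) (fst X (X ⊗ PowObj X))) =
          lift (j ≫ g) (lift Y' x') := by
        have e2 := congrArg (· ≫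
          lift (snd X (X ⊗ PowObj X) ≫ snd X (PowObj X)) (fst X (X ⊗ PowObj X))) e
        simp only [Category.assoc, comp_lift, lift_fst, lift_snd, lift_snd_assoc] at e2
        simp only [comp_lift, e2]
      rw [e', equalizerSubobject_factors_iff, Limits.pullback_factors_iff]
      simp only [comp_lift, lift_fst_assoc, lift_snd_assoc, lift_fst, lift_snd, Category.assoc]
      -- The antecedent replaces `Y'` by the restriction of `p`, so that `y' ∈ Y'` becomes `y' ∈ p`.
      rintro rfl
      rw [dilationRel_factors_iff] at hd
      refine h _ x' y' ?_ hd.1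
      rw [← mem_factors_iff_rel]
      simpa using hd.2

/-- The erosion names a pullback, with no image involved, so its membership condition unfolds
directly; the converse relation `powGe` puts `b` on the smaller side. -/
theorem rel_erosion_factors_iff {Γ Δ X : C} (b : X ⟶ PowObj X) (q : Γ ⟶ PowObj X) (a : Δ ⟶ Γ)
    (y : Δ ⟶ X) : (rel (q ≫ erosion b)).Factors (lift a y) ↔ rel (y ≫ b) ≤ rel (a ≫ q) := by
  rw [rel_comp_factors_iff, erosion, rel_name, ← powLe_factors_iff, powGe,
    Limits.pullback_factors_iff, Limits.pullback_factors_iff]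
  simp

/-- The adjunction between dilation and erosion, for generalized elements. -/
theorem rel_dilation_le_iff_le_erosion {Γ X : C} (b : X ⟶ PowObj X) (p q : Γ ⟶ PowObj X) :
    rel (p ≫ dilation b) ≤ rel q ↔ rel p ≤ rel (q ≫ erosion b) := by
  rw [rel_dilation_le_iff, rel_le_rel_iff]
  constructor
  · intro h Δ a y hy
    rw [rel_erosion_factors_iff, rel_le_rel_iff]
    intro E c x hx
    rw [rel_comp_factors_iff] at hx ⊢
    refine h _ x (c ≫ y) ?_ hx
    simpa using Subobject.factors_of_factors_right c hy
  · intro h Δ a x y hy hx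
    -- Here `x` and `y` live at the same stage, so the inclusion `b(y) ⪯ q` is only needed at the
    -- identity.
    have h' := (rel_le_rel_iff _ _).1 ((rel_erosion_factors_iff b q a y).1 (h a y hy)) (𝟙 _) x
    simp only [rel_comp_factors_iff, Category.id_comp] at h'
    exact h' hx

/-- Transpose `p ≤ q ≤ ε(δ(q))`, the second inequality being the unit of the adjunction. -/
theorem rel_dilation_mono {Γ X : C} (b : X ⟶ PowObj X) {p q : Γ ⟶ PowObj X}
    (h : rel p ≤ rel q) : rel (p ≫ dilation b) ≤ rel (q ≫ dilation b) :=
  (rel_dilation_le_iff_le_erosion b _ _).2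
    (h.trans ((rel_dilation_le_iff_le_erosion b _ _).1 le_rfl))

/-- Transpose `δ(ε(p)) ≤ p ≤ q`, the first inequality being the counit. -/
theorem rel_erosion_mono {Γ X : C} (b : X ⟶ PowObj X) {p q : Γ ⟶ PowObj X}
    (h : rel p ≤ rel q) : rel (p ≫ erosion b) ≤ rel (q ≫ erosion b) :=
  (rel_dilation_le_iff_le_erosion b _ _).1
    (((rel_dilation_le_iff_le_erosion b _ _).2 le_rfl).trans h)

/-! ### Validity of formulas -/

/-- A generalized element of the context satisfies a formula. -/
def Term.Holds {Γ : List C} (φ : Formula Γ) {Δ : C} (γ : Δ ⟶ ctxObj Γ) : Prop :=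
  (classify φ.sem).Factors γ

theorem Term.valid_iff {Γ : List C} (φ : Formula Γ) :
    φ.Valid ↔ ∀ ⦃Δ : C⦄ (γ : Δ ⟶ ctxObj Γ), φ.Holds γ := by
  simp only [Term.Valid, Term.sub, Term.Holds, subobject_eq_iff, Subobject.top_factors, iff_true]

theorem Term.holds_all_iff {Γ : List C} {A : C} (φ : Formula (A :: Γ)) {Δ : C}
    (γ : Δ ⟶ ctxObj Γ) : (Term.all A φ).Holds γ ↔
      ∀ ⦃E : C⦄ (g : E ⟶ Δ) (x : E ⟶ A), φ.Holds (Γ := A :: Γ) (lift x (g ≫ γ)) := by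
  simp only [Term.Holds, Term.sem, chi, Equiv.apply_symm_apply]
  exact forallSnd_factors_iff _ _

theorem Term.holds_imp_iff {Γ : List C} (φ ψ : Formula Γ) {Δ : C} (γ : Δ ⟶ ctxObj Γ) :
    (φ.imp ψ).Holds γ ↔ ∀ ⦃E : C⦄ (g : E ⟶ Δ), φ.Holds (g ≫ γ) → ψ.Holds (g ≫ γ) := by
  simp only [Term.Holds, Term.sem, chi, Equiv.apply_symm_apply]
  exact impSub_factors_iff _ _ _

theorem Term.holds_iff_iff {Γ : List C} (φ ψ : Formula Γ) {Δ : C} (γ : Δ ⟶ ctxObj Γ) :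
    (φ.iff ψ).Holds γ ↔ ∀ ⦃E : C⦄ (g : E ⟶ Δ), φ.Holds (g ≫ γ) ↔ ψ.Holds (g ≫ γ) := by
  have h : (φ.iff ψ).Holds γ ↔ (φ.imp ψ).Holds γ ∧ (ψ.imp φ).Holds γ := by
    simp only [Term.iff, Term.Holds, Term.sem, chi, Equiv.apply_symm_apply]
    exact Subobject.inf_factors _
  rw [h, Term.holds_imp_iff, Term.holds_imp_iff]
  exact ⟨fun h E g => ⟨h.1 g, h.2 g⟩, fun h => ⟨fun E g => (h g).1, fun E g => (h g).2⟩⟩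

theorem Term.holds_le_iff {Γ : List C} {X : C} (s t : Term Γ (PowObj X)) {Δ : C}
    (γ : Δ ⟶ ctxObj Γ) : (s.le t).Holds γ ↔ rel (γ ≫ s.sem) ≤ rel (γ ≫ t.sem) := by
  simp only [Term.Holds, Term.sem, chi, Equiv.apply_symm_apply]
  rw [Limits.pullback_factors_iff, comp_lift, powLe_factors_iff]

/-- The equation `s ∧ t = s` has the same forcing condition as `s ⪯ t`, so one adjunction argument
settles both versions of the Galois formula. -/
theorem holds_leFormula_iff {Γ : List C} {X : C} (s t : Term Γ (PowObj X)) {Δ : C}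
    (γ : Δ ⟶ ctxObj Γ) :
    ((powOps X).leFormula s t).Holds γ ↔ rel (γ ≫ s.sem) ≤ rel (γ ≫ t.sem) := by
  simp only [HeytingOps.leFormula, Term.Holds, Term.sem, chi, Equiv.apply_symm_apply]
  rw [equalizerSubobject_factors_iff, ← meet_eq_left_iff, ← Category.assoc, comp_lift]

/-- The generalized element of a context of two types with the given components. -/
def ctxPair {A B Δ : C} (p : Δ ⟶ A) (q : Δ ⟶ B) : Δ ⟶ ctxObj [B, A] :=
  lift q (lift p (toUnit Δ))

/-- The stage change made by the inner quantifier is absorbed by restricting `p` to `k ≫ p`, and the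
empty context contributes only the unique map to the terminal object. -/
theorem Term.valid_all_all {A B : C} (φ : Formula [B, A])
    (h : ∀ ⦃Δ : C⦄ (p : Δ ⟶ A) (q : Δ ⟶ B), φ.Holds (ctxPair p q)) :
    (Term.all (Γ := []) A (Term.all B φ)).Valid := by
  refine (Term.valid_iff _).2 fun Δ γ => (Term.holds_all_iff _ γ).2 fun E g p =>
    (Term.holds_all_iff (Γ := [A]) φ _).2 fun D k q => ?_
  have e : (k ≫ lift p (g ≫ γ) : D ⟶ A ⊗ 𝟙_ C) = lift (k ≫ p) (toUnit D) :=
    CartesianMonoidalCategory.hom_ext _ _ (by simp) (toUnit_unique _ _)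
  exact (congrArg (Term.Holds φ) (congrArg (lift q) e)).mpr (h (k ≫ p) q)

theorem comp_ctxPair_sem_zero {A B E Δ : C} (g : E ⟶ Δ) (p : Δ ⟶ A) (q : Δ ⟶ B) :
    (g ≫ ctxPair p q) ≫ (Term.var (Var.zero (Γ := [A]) (X := B))).sem = g ≫ q :=
  (Category.assoc _ _ _).trans (congrArg (g ≫ ·) (lift_fst _ _))

theorem comp_ctxPair_sem_one {A B E Δ : C} (g : E ⟶ Δ) (p : Δ ⟶ A) (q : Δ ⟶ B) :
    (g ≫ ctxPair p q) ≫
      (Term.var (Var.succ (Y := B) (Var.zero (Γ := []) (X := A)))).sem = g ≫ p :=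
  (Category.assoc _ _ _).trans
    (congrArg (g ≫ ·) ((lift_snd_assoc _ _ _).trans (lift_fst _ _)))

theorem comp_sem_app {Γ : List C} {X Y Δ : C} (γ : Δ ⟶ ctxObj Γ) (t : Term Γ X) (f : X ⟶ Y) :
    γ ≫ (t.app f).sem = (γ ≫ t.sem) ≫ f :=
  (Category.assoc _ _ _).symm

end Topos

end ToposMorphology

theorem proposition1 {C : Type u} [Category.{v} C] [CartesianMonoidalCategory C]
    [HasFiniteLimits C] [MonoidalClosed C] [HasSubobjectClassifier C]
    {X : C} (b : X ⟶ PowObj X) :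
    -- the closed formula `∀ Y. ∀ Z. δ[b](Y) ⪯ Z ⇔ Y ⪯ ε[b](Z)` is valid
    (Term.all (Γ := []) (PowObj X) (Term.all (PowObj X) (Term.iff
      (Term.le (Term.app (dilation b) (Term.var (Var.succ Var.zero))) (Term.var Var.zero))
      (Term.le (Term.var (Var.succ Var.zero)) (Term.app (erosion b) (Term.var Var.zero)))))).Valid
    ∧ IsInternalHGC (powOps X) (dilation b) (erosion b) := by
  refine ⟨Term.valid_all_all _ fun Δ p q => ?_, isInternalHeyting_powOps X,
    Term.valid_all_all _ fun Δ p q => ?_, Term.valid_all_all _ fun Δ p q => ?_,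
    Term.valid_all_all _ fun Δ p q => ?_⟩
  · rw [Term.holds_iff_iff]
    intro E g
    rw [Term.holds_le_iff, Term.holds_le_iff, comp_sem_app, comp_sem_app, comp_ctxPair_sem_zero,
      comp_ctxPair_sem_one]
    exact rel_dilation_le_iff_le_erosion b _ _
  · rw [Term.holds_imp_iff]
    intro E g
    rw [holds_leFormula_iff, holds_leFormula_iff, comp_sem_app, comp_sem_app, comp_ctxPair_sem_zero,
      comp_ctxPair_sem_one]
    exact rel_dilation_mono b
  · rw [Term.holds_imp_iff]
    intro E g
    rw [holds_leFormula_iff, holds_leFormula_iff, comp_sem_app, comp_sem_app, comp_ctxPair_sem_zero,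
      comp_ctxPair_sem_one]
    exact rel_erosion_mono b
  · rw [Term.holds_iff_iff]
    intro E g
    rw [holds_leFormula_iff, holds_leFormula_iff, comp_sem_app, comp_sem_app, comp_ctxPair_sem_zero,
      comp_ctxPair_sem_one]
    exact rel_dilation_le_iff_le_erosion b _ _
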